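/- There is a universal constant $C < 24$ such that the following holds. Let $G$ be a graph on $n \ge 1$ nodes (the communication graph), and let node $i$ hold $m_i \ge 0$ local functions. An update is either a communication along an edge $\{i,j\}$ of $G$, which has probability $p_{ij}\ge 0$, or a local computation at a node $i$ using its $j$-th local function, which has probability $p^{\rm comp}_{ij}\ge 0$; all these probabilities sum to $1$. A random schedule is a sequence of independent updates drawn from this law. Executing a schedule means that all nodes start at time $0$ and perform the updates they are involved in, in the order of the schedule: a local computation at $i$ involves only $i$, starts as soon as $i$ has finished its previous updates and takes time $1$; a communication along $\{i,j\}$ involves only $i$ and $j$, starts as soon as both have finished their previous updates and takes time $\tau \ge 0$. Let $T(t)$ be the time at which the last node has finished its part of the first $t$ updates, and let $$p^{\max}_{\rm comm} = n \max_i \sum_{j \in \mathcal N(i)} p_{ij},$$ where $\mathcal N(i)$ is the set of neighbors of $i$ in $G$. Assume that every node performs local computations with the same probability $\sum_j p^{\rm comp}_{ij} = p_{\rm comp}/n$, and that $p_{\rm comp} > p^{\max}_{\rm comm}$ or $\tau > 1$. Then $$\mathbb P\big(T(t) \ge \nu t\big) \to 0 \quad\text{as } t \to \infty, \qquad \nu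 = n^{-1} C \left(p_{\rm comp} + \tau\, p^{\max}_{\rm comm}\right).$$ -/

import Mathlib

open MeasureTheory ProbabilityTheory Filter Topology

/-- The updates on a network of `n` nodes with communication graph `G`, in which node `i` holds
`m i` local functions: a communication along an edge of `G`, or a local computation at node `i`
using its `j`-th function (a virtual edge of the augmented graph). -/
inductive Update {n : ℕ} (G : SimpleGraph (Fin n)) (m : Fin n → ℕ) : Type
  | comm (e : G.edgeSet) : Update G m
  | comp (i : Fin n) (j : Fin (m i)) : Update G m

/-- The (finite) set of updates carries the discrete σ-algebra. -/
instance {n : ℕ} (G : SimpleGraph (Fin n)) (m : Fin n → ℕ) : MeasurableSpace (Update G m) := ⊤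

section

variable {n : ℕ} {G : SimpleGraph (Fin n)} {m : Fin n → ℕ}

open Classical in
/-- Given the times `T k` at which the nodes become available, the times at which they become
available after the given update. A communication along `{k, l}` starts when both `k` and `l` are
available, lasts `τ` and occupies exactly these two nodes; a local computation at `k` starts when
`k` is available, lasts `1` and occupies `k` only. -/
noncomputable def Update.exec (τ : ℝ) (u : Update G m) (T : Fin n → ℝ) : Fin n → ℝ :=
  match u with
  | .comm e => fun i => if i ∈ (e : Sym2 (Fin n)) then (Sym2.map T e).sup + τ else T i
  | .comp k _ => fun i => if i = k then T i + 1 else T i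

/-- `nodeTime τ σ t i` is the time at which node `i` is done with its part of the first `t`
updates of the schedule `σ`, all nodes starting at time `0`. -/
noncomputable def nodeTime (τ : ℝ) (σ : ℕ → Update G m) : ℕ → Fin n → ℝ
  | 0 => fun _ => 0
  | t + 1 => (σ t).exec τ (nodeTime τ σ t)

/-- The time `T(t)` needed to execute the first `t` updates of the schedule `σ`: the time at which
the last node is done. -/
noncomputable def execTime (τ : ℝ) (σ : ℕ → Update G m) (t : ℕ) : ℝ :=
  ⨆ i, nodeTime τ σ t i

/-- The probability `∑_{j ∈ V_i} p_{ij}` that a given update is a local computation at `i`. -/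
noncomputable def nodeCompProb (p : PMF (Update G m)) (i : Fin n) : ℝ :=
  ∑ j : Fin (m i), (p (.comp i j)).toReal

open Classical in
/-- The probability `∑_{j ∈ N(i)} p_{ij}` that a given update is a communication involving `i`. -/
noncomputable def nodeCommProb (p : PMF (Update G m)) (i : Fin n) : ℝ :=
  ∑ j : G.neighborSet i, (p (.comm ⟨s(i, (j : Fin n)), j.2⟩)).toReal

/-- `p^max_comm = n max_i ∑_{j ∈ N(i)} p_{ij}`. -/
noncomputable def pMaxComm (p : PMF (Update G m)) : ℝ :=
  n * ⨆ i, nodeCommProb p i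

end

/-!
For `θ > 0` the potential `∑ i, exp (θ T i)` of the availability times grows on average by a factor
of at most `1 + (2 exp (θ τ) - 1) r + (exp θ - 1) q` per update, where `q` and `r` bound the
probabilities that an update is a local computation at, or a communication involving, a given node:
a communication along `{k, l}` replaces `exp (θ T k) + exp (θ T l)` by
`2 exp (θ τ) exp (θ max (T k) (T l))`, which is at most
`2 exp (θ τ) (exp (θ T k) + exp (θ T l))`. Since the updates are independent, the mean potential
after `t` updates is at most `n` times the `t`-th power of this factor, and Markov's inequality
makes `ℙ(ν t ≤ T(t))` decay geometrically as soon as the factor is less than `exp (θ ν)`. If `r ≤ q`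
or `1 ≤ τ`, then `θ = 1 / max 1 τ` satisfies `r ≤ θ (q + τ r)`, and `exp x - 1 ≤ 2 x` on `[0, 1]`
shows that `ν = 5 (q + τ r)` is large enough.
-/

section DrivenOrbit

variable {α S Ω : Type*}

/-- The trajectory of the random iteration `x, f a₀ x, f a₁ (f a₀ x), …` started at `x` and driven
by the sequence `a`: the form in which Foster–Lyapunov drift bounds are stated. -/
def drivenOrbit (f : α → S → S) (x : S) (a : ℕ → α) : ℕ → S
  | 0 => x
  | t + 1 => f (a t) (drivenOrbit f x a t)

variable [MeasurableSpace α] [MeasurableSpace S] [MeasurableSpace Ω]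
  {P : Measure Ω} {μ : Measure α} {ξ : ℕ → Ω → α} {f : α → S → S} {V : S → ENNReal} {c : ENNReal}

theorem exists_measurable_drivenOrbit_eq_restrict (hf : Measurable (Function.uncurry f)) (x : S)
    (t : ℕ) :
    ∃ g : (Finset.range t → α) → S, Measurable g ∧
      ∀ a, drivenOrbit f x a t = g ((Finset.range t).restrict a) := by
  induction t with
  | zero => exact ⟨fun _ => x, measurable_const, fun _ => rfl⟩
  | succ t ih =>
    obtain ⟨g, hg, hga⟩ := ih
    have hsub : Finset.range t ⊆ Finset.range (t + 1) := Finset.range_subset_range.2 t.le_succ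
    have hlast : Measurable fun v : Finset.range (t + 1) → α =>
        v ⟨t, Finset.self_mem_range_succ t⟩ := measurable_pi_apply _
    exact ⟨fun v => f (v ⟨t, Finset.self_mem_range_succ t⟩)
        (g (Finset.restrict₂ (π := fun _ => α) hsub v)),
      hf.comp (hlast.prodMk (hg.comp (Finset.measurable_restrict₂ hsub))),
      fun a => congrArg (f (a t)) (hga a)⟩

theorem aemeasurable_drivenOrbit (hξ : ∀ k, AEMeasurable (ξ k) P)
    (hf : Measurable (Function.uncurry f)) (x : S) (t : ℕ) :
    AEMeasurable (fun ω => drivenOrbit f x (ξ · ω) t) P := by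
  obtain ⟨g, hg, hga⟩ := exists_measurable_drivenOrbit_eq_restrict hf x t
  simp_rw [hga]
  exact hg.comp_aemeasurable (aemeasurable_pi_lambda _ fun k => hξ k)

theorem indepFun_drivenOrbit (hindep : iIndepFun ξ P) (hξ : ∀ k, AEMeasurable (ξ k) P)
    (hf : Measurable (Function.uncurry f)) (x : S) (t : ℕ) :
    IndepFun (fun ω => drivenOrbit f x (ξ · ω) t) (ξ t) P := by
  obtain ⟨g, hg, hga⟩ := exists_measurable_drivenOrbit_eq_restrict hf x t
  simp_rw [hga]
  exact (hindep.indepFun_finset₀ (Finset.range t) {t} (by simp) hξ).comp hg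
    (measurable_pi_apply (⟨t, Finset.mem_singleton_self t⟩ : ({t} : Finset ℕ)))

theorem lintegral_drivenOrbit_succ (hindep : iIndepFun ξ P) (hξ : ∀ k, HasLaw (ξ k) μ P)
    (hf : Measurable (Function.uncurry f)) (hV : Measurable V) (x : S) (t : ℕ) :
    ∫⁻ ω, V (drivenOrbit f x (ξ · ω) (t + 1)) ∂P =
      ∫⁻ ω, ∫⁻ a, V (f a (drivenOrbit f x (ξ · ω) t)) ∂μ ∂P := by
  have := hindep.isProbabilityMeasure
  have hμ : IsProbabilityMeasure μ := (hξ t).isProbabilityMeasure_iff.1 this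
  have hξm : ∀ k, AEMeasurable (ξ k) P := fun k => (hξ k).aemeasurable
  have hX := aemeasurable_drivenOrbit hξm hf x t
  have hF : Measurable fun z : S × α => V (f z.2 z.1) :=
    hV.comp (hf.comp measurable_swap)
  have hlaw := (indepFun_drivenOrbit hindep hξm hf x t).hasLaw_prod ⟨hX, rfl⟩ (hξ t)
  calc ∫⁻ ω, V (f (ξ t ω) (drivenOrbit f x (ξ · ω) t)) ∂P
      = ∫⁻ z, V (f z.2 z.1) ∂(P.map fun ω => drivenOrbit f x (ξ · ω) t).prod μ :=
        hlaw.lintegral_comp hF.aemeasurable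
    _ = ∫⁻ ω, ∫⁻ a, V (f a (drivenOrbit f x (ξ · ω) t)) ∂μ ∂P := by
        rw [lintegral_prod _ hF.aemeasurable,
          lintegral_map' hF.lintegral_prod_right'.aemeasurable hX]

theorem lintegral_drivenOrbit_le (hindep : iIndepFun ξ P) (hξ : ∀ k, HasLaw (ξ k) μ P)
    (hf : Measurable (Function.uncurry f)) (hV : Measurable V)
    (hdrift : ∀ s, ∫⁻ a, V (f a s) ∂μ ≤ c * V s) (x : S) (t : ℕ) :
    ∫⁻ ω, V (drivenOrbit f x (ξ · ω) t) ∂P ≤ c ^ t * V x := by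
  induction t with
  | zero =>
    have := hindep.isProbabilityMeasure
    simp [drivenOrbit]
  | succ t ih =>
    calc ∫⁻ ω, V (drivenOrbit f x (ξ · ω) (t + 1)) ∂P
        = ∫⁻ ω, ∫⁻ a, V (f a (drivenOrbit f x (ξ · ω) t)) ∂μ ∂P :=
          lintegral_drivenOrbit_succ hindep hξ hf hV x t
      _ ≤ ∫⁻ ω, c * V (drivenOrbit f x (ξ · ω) t) ∂P := lintegral_mono fun ω => hdrift _
      _ = c * ∫⁻ ω, V (drivenOrbit f x (ξ · ω) t) ∂P :=
          lintegral_const_mul'' _ (hV.comp_aemeasurable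
            (aemeasurable_drivenOrbit (fun k => (hξ k).aemeasurable) hf x t))
      _ ≤ c * (c ^ t * V x) := by gcongr
      _ = c ^ (t + 1) * V x := by rw [pow_succ', mul_assoc]

theorem measure_mul_le_drivenOrbit_le (hindep : iIndepFun ξ P) (hξ : ∀ k, HasLaw (ξ k) μ P)
    (hf : Measurable (Function.uncurry f)) (hV : Measurable V)
    (hdrift : ∀ s, ∫⁻ a, V (f a s) ∂μ ≤ c * V s) {Φ : S → ℝ}
    (hΦ : ∀ s, ENNReal.ofReal (Real.exp (Φ s)) ≤ V s) (x : S) (b : ℝ) (t : ℕ) :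
    P {ω | b * t ≤ Φ (drivenOrbit f x (ξ · ω) t)} ≤
      (c / ENNReal.ofReal (Real.exp b)) ^ t * V x := by
  have hpow : ENNReal.ofReal (Real.exp (b * t)) = ENNReal.ofReal (Real.exp b) ^ t := by
    rw [mul_comm, Real.exp_nat_mul, ENNReal.ofReal_pow (Real.exp_pos b).le]
  have hVm : AEMeasurable (fun ω => V (drivenOrbit f x (ξ · ω) t)) P :=
    hV.comp_aemeasurable (aemeasurable_drivenOrbit (fun k => (hξ k).aemeasurable) hf x t)
  calc P {ω | b * t ≤ Φ (drivenOrbit f x (ξ · ω) t)}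
      ≤ P {ω | ENNReal.ofReal (Real.exp (b * t)) ≤ V (drivenOrbit f x (ξ · ω) t)} :=
        measure_mono fun ω hω =>
          (ENNReal.ofReal_le_ofReal (Real.exp_le_exp.2 hω)).trans (hΦ _)
    _ ≤ (∫⁻ ω, V (drivenOrbit f x (ξ · ω) t) ∂P) / ENNReal.ofReal (Real.exp (b * t)) :=
        meas_ge_le_lintegral_div hVm (by simp [Real.exp_pos]) ENNReal.ofReal_ne_top
    _ ≤ c ^ t * V x / ENNReal.ofReal (Real.exp (b * t)) := by
        gcongr
        exact lintegral_drivenOrbit_le hindep hξ hf hV hdrift x t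
    _ = (c / ENNReal.ofReal (Real.exp b)) ^ t * V x := by
        rw [hpow, div_eq_mul_inv, div_eq_mul_inv, mul_pow, ENNReal.inv_pow, mul_right_comm]

theorem tendsto_measure_mul_le_drivenOrbit (hindep : iIndepFun ξ P)
    (hξ : ∀ k, HasLaw (ξ k) μ P) (hf : Measurable (Function.uncurry f)) (hV : Measurable V)
    (hdrift : ∀ s, ∫⁻ a, V (f a s) ∂μ ≤ c * V s) {Φ : S → ℝ}
    (hΦ : ∀ s, ENNReal.ofReal (Real.exp (Φ s)) ≤ V s) {x : S} (hx : V x ≠ ⊤) {b : ℝ}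
    (hc : c < ENNReal.ofReal (Real.exp b)) :
    Tendsto (fun t : ℕ => P {ω | b * t ≤ Φ (drivenOrbit f x (ξ · ω) t)}) atTop (𝓝 0) := by
  have hlt : c / ENNReal.ofReal (Real.exp b) < 1 :=
    ENNReal.div_lt_of_lt_mul' (by rwa [mul_one])
  have hlim := ENNReal.Tendsto.mul_const (ENNReal.tendsto_pow_atTop_nhds_zero_of_lt_one hlt)
    (Or.inr hx)
  rw [zero_mul] at hlim
  exact tendsto_of_tendsto_of_tendsto_of_le_of_le tendsto_const_nhds hlim (fun _ => zero_le)
    (measure_mul_le_drivenOrbit_le hindep hξ hf hV hdrift hΦ x b)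

end DrivenOrbit

section ExpPotential

variable {ι : Type*} [Fintype ι]

/-- The exponential potential `∑ i, exp (θ T i)`, an upper bound for `exp (θ maxᵢ T i)` that serves
as the Lyapunov function of the vector of availability times. -/
noncomputable def expPotential (θ : ℝ) (T : ι → ℝ) : ℝ := ∑ i, Real.exp (θ * T i)

theorem expPotential_nonneg (θ : ℝ) (T : ι → ℝ) : 0 ≤ expPotential θ T :=
  Finset.sum_nonneg fun _ _ => (Real.exp_pos _).le

@[fun_prop]
theorem measurable_expPotential (θ : ℝ) : Measurable (expPotential θ : (ι → ℝ) → ℝ) := by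
  unfold expPotential
  fun_prop

theorem exp_mul_iSup_le_expPotential [Nonempty ι] {θ : ℝ} (T : ι → ℝ) :
    Real.exp (θ * ⨆ i, T i) ≤ expPotential θ T := by
  obtain ⟨i, hi⟩ := exists_eq_ciSup_of_finite (f := T)
  rw [← hi]
  exact Finset.single_le_sum (f := fun i => Real.exp (θ * T i))
    (fun _ _ => (Real.exp_pos _).le) (Finset.mem_univ i)

end ExpPotential

theorem sum_toReal_eq_toMeasure_real_range {α ι : Type*} [MeasurableSpace α]
    [MeasurableSingletonClass α] [Fintype ι] (p : PMF α) {g : ι → α} (hg : Function.Injective g) :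
    ∑ i, (p (g i)).toReal = p.toMeasure.real (Set.range g) := by
  classical
  rw [← Set.image_univ, ← Finset.coe_univ, ← Finset.coe_image, ← sum_measureReal_singleton,
    Finset.sum_image hg.injOn]
  simp only [measureReal_def, p.toMeasure_apply_singleton _ (measurableSet_singleton _)]

theorem exp_sub_one_le_two_mul {x : ℝ} (h0 : 0 ≤ x) (h1 : x ≤ 1) : Real.exp x - 1 ≤ 2 * x := by
  simpa only [abs_of_nonneg h0] using
    (le_abs_self _).trans (Real.abs_exp_sub_one_le ((abs_of_nonneg h0).trans_le h1))

theorem growth_rate_le_mul {θ q r τ : ℝ} (hq : 0 ≤ q) (hr : 0 ≤ r) (hτ : 0 ≤ τ) (hθ : 0 ≤ θ)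
    (hθ1 : θ ≤ 1) (hθτ : θ * τ ≤ 1) (hrθ : r ≤ θ * (q + τ * r)) :
    (2 * Real.exp (θ * τ) - 1) * r + (Real.exp θ - 1) * q ≤ θ * (5 * (q + τ * r)) :=
  calc (2 * Real.exp (θ * τ) - 1) * r + (Real.exp θ - 1) * q
      = r + 2 * (Real.exp (θ * τ) - 1) * r + (Real.exp θ - 1) * q := by ring
    _ ≤ θ * (q + τ * r) + 2 * (2 * (θ * τ)) * r + 2 * θ * q := by
        gcongr
        exacts [exp_sub_one_le_two_mul (mul_nonneg hθ hτ) hθτ, exp_sub_one_le_two_mul hθ hθ1]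
    _ ≤ θ * (5 * (q + τ * r)) := by linarith [mul_nonneg hθ hq]

theorem exists_exponent_le_mul_add {q r τ : ℝ} (hq : 0 ≤ q) (hr : 0 ≤ r) (hτ : 0 ≤ τ)
    (h : r ≤ q ∨ 1 ≤ τ) :
    ∃ θ : ℝ, 0 < θ ∧ θ ≤ 1 ∧ θ * τ ≤ 1 ∧ r ≤ θ * (q + τ * r) := by
  rcases le_total 1 τ with hτ1 | hτ1
  · have hτ0 : 0 < τ := one_pos.trans_le hτ1
    refine ⟨τ⁻¹, inv_pos.2 hτ0, inv_le_one_of_one_le₀ hτ1, (inv_mul_cancel₀ hτ0.ne').le, ?_⟩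
    rw [mul_add, inv_mul_cancel_left₀ hτ0.ne']
    exact le_add_of_nonneg_left (by positivity)
  · refine ⟨1, one_pos, le_rfl, by rwa [one_mul], ?_⟩
    rcases h with hrq | hτ1'
    · linarith [mul_nonneg hτ hr]
    · linarith [le_mul_of_one_le_left hr hτ1']

theorem exists_one_add_growth_rate_lt_exp {q r τ : ℝ} (hq : 0 ≤ q) (hr : 0 ≤ r) (hqr : 0 < q + r)
    (hτ : 0 ≤ τ) (h : r ≤ q ∨ 1 ≤ τ) :
    ∃ θ : ℝ, 0 < θ ∧ 1 + ((2 * Real.exp (θ * τ) - 1) * r + (Real.exp θ - 1) * q) <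
      Real.exp (θ * (5 * (q + τ * r))) := by
  obtain ⟨θ, hθ, hθ1, hθτ, hrθ⟩ := exists_exponent_le_mul_add hq hr hτ h
  have hpos : 0 < q + τ * r := by
    rcases h with hrq | hτ1
    · have hq_pos : 0 < q := by linarith
      positivity
    · exact hqr.trans_le (add_le_add_right (le_mul_of_one_le_left hr hτ1) q)
  refine ⟨θ, hθ, ?_⟩
  calc 1 + ((2 * Real.exp (θ * τ) - 1) * r + (Real.exp θ - 1) * q)
      ≤ θ * (5 * (q + τ * r)) + 1 := by
        linarith [growth_rate_le_mul hq hr hτ hθ.le hθ1 hθτ hrθ]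
    _ < Real.exp (θ * (5 * (q + τ * r))) := Real.add_one_lt_exp (by positivity)

section Network

variable {n : ℕ} {G : SimpleGraph (Fin n)} {m : Fin n → ℕ}

instance : Finite (Update G m) :=
  Finite.of_surjective
    (Sum.elim Update.comm fun x => Update.comp x.1 x.2 : G.edgeSet ⊕ (Σ i, Fin (m i)) → Update G m)
    fun
      | .comm e => ⟨.inl e, rfl⟩
      | .comp i j => ⟨.inr ⟨i, j⟩, rfl⟩

instance : DiscreteMeasurableSpace (Update G m) := ⟨fun _ => trivial⟩

variable (G m) in
/-- The event that an update is a communication involving node `i`, indexed by the other endpoint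
as in `nodeCommProb`. -/
def commUpdates (i : Fin n) : Set (Update G m) :=
  Set.range fun j : G.neighborSet i => .comm ⟨s(i, (j : Fin n)), j.2⟩

variable (G m) in
/-- The event that an update is a local computation at node `i`. -/
def compUpdates (i : Fin n) : Set (Update G m) := Set.range (.comp i)

@[simp]
theorem comm_mem_commUpdates {e : G.edgeSet} {i : Fin n} :
    .comm e ∈ commUpdates G m i ↔ i ∈ (e : Sym2 (Fin n)) := by
  obtain ⟨e, he⟩ := e
  constructor
  · rintro ⟨j, hj⟩
    obtain rfl : s(i, (j : Fin n)) = e := congrArg Subtype.val (Update.comm.inj hj)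
    exact Sym2.mem_mk_left i j
  · rintro ⟨j, rfl⟩
    exact ⟨⟨j, he⟩, rfl⟩

@[simp]
theorem comp_notMem_commUpdates {k i : Fin n} {j : Fin (m k)} : .comp k j ∉ commUpdates G m i := by
  simp [commUpdates]

@[simp]
theorem comm_notMem_compUpdates {e : G.edgeSet} {i : Fin n} : .comm e ∉ compUpdates G m i := by
  simp [compUpdates]

@[simp]
theorem comp_mem_compUpdates {k i : Fin n} {j : Fin (m k)} :
    .comp k j ∈ compUpdates G m i ↔ i = k := by
  constructor
  · rintro ⟨l, hl⟩
    cases hl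
    rfl
  · rintro rfl
    exact Set.mem_range_self j

theorem Update.exists_mem_commUpdates_union_compUpdates (u : Update G m) :
    ∃ i, u ∈ commUpdates G m i ∪ compUpdates G m i := by
  rcases u with e | ⟨i, j⟩
  · exact ⟨_, .inl (comm_mem_commUpdates.2 (Sym2.out_fst_mem (e : Sym2 (Fin n))))⟩
  · exact ⟨i, .inr (comp_mem_compUpdates.2 rfl)⟩

theorem nodeCommProb_eq_toMeasure_real (p : PMF (Update G m)) (i : Fin n) :
    nodeCommProb p i = p.toMeasure.real (commUpdates G m i) := by
  classical
  exact sum_toReal_eq_toMeasure_real_range p fun j k hjk =>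
    Subtype.ext (Sym2.congr_right.1 (congrArg Subtype.val (Update.comm.inj hjk)))

theorem nodeCompProb_eq_toMeasure_real (p : PMF (Update G m)) (i : Fin n) :
    nodeCompProb p i = p.toMeasure.real (compUpdates G m i) :=
  sum_toReal_eq_toMeasure_real_range p fun j k hjk => by simpa using hjk

theorem nodeCommProb_nonneg (p : PMF (Update G m)) (i : Fin n) : 0 ≤ nodeCommProb p i :=
  Finset.sum_nonneg fun _ _ => ENNReal.toReal_nonneg

theorem nodeCompProb_nonneg (p : PMF (Update G m)) (i : Fin n) : 0 ≤ nodeCompProb p i :=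
  Finset.sum_nonneg fun _ _ => ENNReal.toReal_nonneg

theorem exists_nodeCompProb_add_nodeCommProb_pos (p : PMF (Update G m)) :
    ∃ i, 0 < nodeCompProb p i + nodeCommProb p i := by
  obtain ⟨u, hu⟩ := p.support_nonempty
  obtain ⟨i, hi⟩ := u.exists_mem_commUpdates_union_compUpdates
  refine ⟨i, ?_⟩
  calc 0 < (p u).toReal := ENNReal.toReal_pos hu (p.apply_ne_top u)
    _ = p.toMeasure.real {u} := by
        rw [measureReal_def, p.toMeasure_apply_singleton u (measurableSet_singleton u)]
    _ ≤ p.toMeasure.real (commUpdates G m i ∪ compUpdates G m i) :=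
        measureReal_mono (Set.singleton_subset_iff.2 hi)
    _ ≤ p.toMeasure.real (commUpdates G m i) + p.toMeasure.real (compUpdates G m i) :=
        measureReal_union_le _ _
    _ = nodeCompProb p i + nodeCommProb p i := by
        rw [nodeCommProb_eq_toMeasure_real, nodeCompProb_eq_toMeasure_real, add_comm]

theorem nodeCommProb_le_pMaxComm_div (p : PMF (Update G m)) (i : Fin n) :
    nodeCommProb p i ≤ pMaxComm p / n := by
  have hn : (n : ℝ) ≠ 0 := Nat.cast_ne_zero.2 i.pos.ne'
  rw [pMaxComm, mul_div_cancel_left₀ _ hn]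
  exact le_ciSup (Set.finite_range _).bddAbove i

theorem measurable_exec (τ : ℝ) :
    Measurable (Function.uncurry (Update.exec τ : Update G m → (Fin n → ℝ) → Fin n → ℝ)) := by
  classical
  refine measurable_from_prod_countable_right fun u => measurable_pi_lambda _ fun i => ?_
  rcases u with ⟨e, he⟩ | ⟨k, j⟩
  · induction e with
    | _ k l =>
      simp only [Function.uncurry, Update.exec, Sym2.map_mk, Sym2.sup_mk]
      split_ifs <;> fun_prop
  · simp only [Function.uncurry, Update.exec]
    split_ifs <;> fun_prop

theorem nodeTime_eq_drivenOrbit (τ : ℝ) (σ : ℕ → Update G m) (t : ℕ) :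
    nodeTime τ σ t = drivenOrbit (Update.exec τ) 0 σ t := by
  induction t with
  | zero => rfl
  | succ t ih => rw [nodeTime, drivenOrbit, ih]

/-- The relative growth charged to node `i` in the exponential potential under the update `u`. A
communication costs its endpoints `2 exp (θ τ)` rather than `exp (θ τ)`, because the maximum of the
two availability times is bounded by the sum of the two exponentials. -/
noncomputable def Update.growth (θ τ : ℝ) (u : Update G m) (i : Fin n) : ℝ :=
  (commUpdates G m i).indicator (fun _ => 2 * Real.exp (θ * τ) - 1) u +
    (compUpdates G m i).indicator (fun _ => Real.exp θ - 1) u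

theorem expPotential_exec_comm_le (θ τ : ℝ) (e : G.edgeSet) (T : Fin n → ℝ) :
    expPotential θ ((.comm e : Update G m).exec τ T) ≤
      ∑ i, (1 + (.comm e : Update G m).growth θ τ i) * Real.exp (θ * T i) := by
  classical
  obtain ⟨e, he⟩ := e
  induction e with
  | _ k l =>
    have hkl : k ≠ l := G.ne_of_adj he
    have hmax : Real.exp (θ * (T k ⊔ T l + τ)) ≤
        Real.exp (θ * τ) * (Real.exp (θ * T k) + Real.exp (θ * T l)) := by
      rw [mul_add, Real.exp_add, mul_comm]
      gcongr
      rcases max_choice (T k) (T l) with h | h <;> rw [h]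
      · exact le_add_of_nonneg_right (Real.exp_pos _).le
      · exact le_add_of_nonneg_left (Real.exp_pos _).le
    rw [expPotential, ← Finset.sum_add_sum_compl {k, l},
      ← Finset.sum_add_sum_compl {k, l} fun i => (1 + _) * Real.exp (θ * T i)]
    refine add_le_add ?_ (Finset.sum_congr rfl fun i hi => ?_).le
    · simp only [Finset.sum_pair hkl, Update.exec, Update.growth, Sym2.map_mk, Sym2.sup_mk]
      simp only [Sym2.mem_iff, true_or, or_true, ↓reduceIte, comm_mem_commUpdates,
        comm_notMem_compUpdates, not_false_eq_true, Set.indicator_of_mem,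
        Set.indicator_of_notMem, add_zero, add_sub_cancel]
      linarith
    · have hi' : i ∉ s(k, l) := by simpa using hi
      simp [Update.exec, Update.growth, hi']

theorem expPotential_exec_comp (θ τ : ℝ) (k : Fin n) (j : Fin (m k)) (T : Fin n → ℝ) :
    expPotential θ ((.comp k j : Update G m).exec τ T) =
      ∑ i, (1 + (.comp k j : Update G m).growth θ τ i) * Real.exp (θ * T i) := by
  refine Finset.sum_congr rfl fun i _ => ?_
  by_cases h : i = k
  · simp [Update.exec, Update.growth, h, mul_add, Real.exp_add, mul_comm]
  · simp [Update.exec, Update.growth, h]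

theorem expPotential_exec_le (θ τ : ℝ) (u : Update G m) (T : Fin n → ℝ) :
    expPotential θ (u.exec τ T) ≤ ∑ i, (1 + u.growth θ τ i) * Real.exp (θ * T i) := by
  rcases u with e | ⟨k, j⟩
  · exact expPotential_exec_comm_le θ τ e T
  · exact (expPotential_exec_comp θ τ k j T).le

theorem integral_growth (p : PMF (Update G m)) (θ τ : ℝ) (i : Fin n) :
    ∫ u, u.growth θ τ i ∂p.toMeasure =
      (2 * Real.exp (θ * τ) - 1) * nodeCommProb p i + (Real.exp θ - 1) * nodeCompProb p i := by
  simp only [Update.growth]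
  rw [integral_add .of_finite .of_finite, integral_indicator_const _ (.of_discrete),
    integral_indicator_const _ (.of_discrete), nodeCommProb_eq_toMeasure_real,
    nodeCompProb_eq_toMeasure_real, smul_eq_mul, smul_eq_mul, mul_comm, mul_comm (Real.exp θ - 1)]

theorem integral_expPotential_exec_le (p : PMF (Update G m)) {θ τ q r : ℝ} (hθ : 0 ≤ θ)
    (hτ : 0 ≤ τ) (hq : ∀ i, nodeCompProb p i ≤ q) (hr : ∀ i, nodeCommProb p i ≤ r)
    (T : Fin n → ℝ) :
    ∫ u, expPotential θ (u.exec τ T) ∂p.toMeasure ≤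
      (1 + ((2 * Real.exp (θ * τ) - 1) * r + (Real.exp θ - 1) * q)) * expPotential θ T := by
  have hcomm : 0 ≤ 2 * Real.exp (θ * τ) - 1 := by
    linarith [Real.one_le_exp (mul_nonneg hθ hτ)]
  have hcomp : 0 ≤ Real.exp θ - 1 := sub_nonneg.2 (Real.one_le_exp hθ)
  calc ∫ u, expPotential θ (u.exec τ T) ∂p.toMeasure
      ≤ ∫ u : Update G m, ∑ i, (1 + u.growth θ τ i) * Real.exp (θ * T i) ∂p.toMeasure :=
        integral_mono .of_finite .of_finite fun u => expPotential_exec_le θ τ u T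
    _ = ∑ i, (1 + ∫ u : Update G m, u.growth θ τ i ∂p.toMeasure) * Real.exp (θ * T i) := by
        rw [integral_finsetSum _ fun i _ => .of_finite]
        refine Finset.sum_congr rfl fun i _ => ?_
        rw [integral_mul_const, integral_add .of_finite .of_finite, integral_const,
          probReal_univ, one_smul]
    _ ≤ ∑ i, (1 + ((2 * Real.exp (θ * τ) - 1) * r + (Real.exp θ - 1) * q)) *
          Real.exp (θ * T i) := by
        gcongr with i
        rw [integral_growth]
        gcongr
        exacts [hr i, hq i]
    _ = (1 + ((2 * Real.exp (θ * τ) - 1) * r + (Real.exp θ - 1) * q)) * expPotential θ T := by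
        rw [expPotential, Finset.mul_sum]

theorem lintegral_expPotential_exec_le (p : PMF (Update G m)) {θ τ q r : ℝ} (hθ : 0 ≤ θ)
    (hτ : 0 ≤ τ) (hq : ∀ i, nodeCompProb p i ≤ q) (hr : ∀ i, nodeCommProb p i ≤ r)
    (T : Fin n → ℝ) :
    ∫⁻ u, ENNReal.ofReal (expPotential θ (u.exec τ T)) ∂p.toMeasure ≤
      ENNReal.ofReal (1 + ((2 * Real.exp (θ * τ) - 1) * r + (Real.exp θ - 1) * q)) *
        ENNReal.ofReal (expPotential θ T) := by
  rw [← ofReal_integral_eq_lintegral_ofReal .of_finite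
      (ae_of_all _ fun _ => expPotential_nonneg θ _),
    ← ENNReal.ofReal_mul' (expPotential_nonneg θ T)]
  exact ENNReal.ofReal_le_ofReal (integral_expPotential_exec_le p hθ hτ hq hr T)

theorem tendsto_measure_mul_le_execTime {p : PMF (Update G m)} {Ω : Type*} [MeasurableSpace Ω]
    {P : Measure Ω} {ξ : ℕ → Ω → Update G m} (hindep : iIndepFun ξ P)
    (hξ : ∀ k, HasLaw (ξ k) p.toMeasure P) {θ τ q r ν : ℝ} (hθ : 0 < θ) (hτ : 0 ≤ τ)
    (hq : ∀ i, nodeCompProb p i ≤ q) (hr : ∀ i, nodeCommProb p i ≤ r)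
    (hν : 1 + ((2 * Real.exp (θ * τ) - 1) * r + (Real.exp θ - 1) * q) < Real.exp (θ * ν)) :
    Tendsto (fun t : ℕ => P {ω | ν * t ≤ execTime τ (ξ · ω) t}) atTop (𝓝 0) := by
  have : Nonempty (Fin n) := (exists_nodeCompProb_add_nodeCommProb_pos p).nonempty
  have htail := tendsto_measure_mul_le_drivenOrbit hindep hξ (measurable_exec τ)
    (V := fun T => ENNReal.ofReal (expPotential θ T)) (by fun_prop)
    (lintegral_expPotential_exec_le p hθ.le hτ hq hr) (Φ := fun T => θ * ⨆ i, T i)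
    (fun T => ENNReal.ofReal_le_ofReal (exp_mul_iSup_le_expPotential T)) (x := 0)
    ENNReal.ofReal_ne_top ((ENNReal.ofReal_lt_ofReal_iff (Real.exp_pos _)).2 hν)
  simpa only [execTime, ← nodeTime_eq_drivenOrbit, mul_assoc, mul_le_mul_iff_right₀ hθ] using htail

end Network

theorem theorem4_general {n : ℕ} {G : SimpleGraph (Fin n)} {m : Fin n → ℕ} {p : PMF (Update G m)}
    {pcomp τ : ℝ} (hτ : 0 ≤ τ) (hcomp : ∀ i, nodeCompProb p i ≤ pcomp / n)
    (hcase : pMaxComm p ≤ pcomp ∨ 1 ≤ τ) {Ω : Type*} [MeasurableSpace Ω] {P : Measure Ω}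
    {ξ : ℕ → Ω → Update G m} (hindep : iIndepFun ξ P) (hξ : ∀ k, HasLaw (ξ k) p.toMeasure P) :
    Tendsto
      (fun t : ℕ => P {ω | (n : ℝ)⁻¹ * 5 * (pcomp + τ * pMaxComm p) * t ≤ execTime τ (ξ · ω) t})
      atTop (𝓝 0) := by
  obtain ⟨i, hi⟩ := exists_nodeCompProb_add_nodeCommProb_pos p
  have hcomm := nodeCommProb_le_pMaxComm_div p
  have hq : 0 ≤ pcomp / n := (nodeCompProb_nonneg p i).trans (hcomp i)
  have hr : 0 ≤ pMaxComm p / n := (nodeCommProb_nonneg p i).trans (hcomm i)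
  have hcase' : pMaxComm p / n ≤ pcomp / n ∨ 1 ≤ τ :=
    hcase.imp_left fun h => div_le_div_of_nonneg_right h n.cast_nonneg
  have hpos : 0 < pcomp / n + pMaxComm p / n := hi.trans_le (add_le_add (hcomp i) (hcomm i))
  obtain ⟨θ, hθ, hgrowth⟩ := exists_one_add_growth_rate_lt_exp hq hr hpos hτ hcase'
  have hν : (n : ℝ)⁻¹ * 5 * (pcomp + τ * pMaxComm p) =
      5 * (pcomp / n + τ * (pMaxComm p / n)) := by ring
  rw [hν]
  exact tendsto_measure_mul_le_execTime hindep hξ hθ hτ hcomp hcomm hgrowth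

theorem theorem4 :
    ∃ C : ℝ, C < 24 ∧
      ∀ (n : ℕ) (_ : 0 < n) (G : SimpleGraph (Fin n)) (m : Fin n → ℕ)
        (p : PMF (Update G m)) (pcomp τ : ℝ) (_ : 0 ≤ τ)
        (_ : ∀ i, nodeCompProb p i = pcomp / n)
        (_ : pMaxComm p < pcomp ∨ 1 < τ)
        (Ω : Type*) (_ : MeasurableSpace Ω) (P : Measure Ω) (_ : IsProbabilityMeasure P)
        -- the random schedule: independent updates drawn with the probabilities `p`
        (ξ : ℕ → Ω → Update G m) (_ : iIndepFun ξ P) (_ : ∀ k, HasLaw (ξ k) p.toMeasure P),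
        Tendsto
          (fun t : ℕ =>
            P {ω | (n : ℝ)⁻¹ * C * (pcomp + τ * pMaxComm p) * t ≤ execTime τ (fun k => ξ k ω) t})
          atTop (𝓝 0) := by
  refine ⟨5, by norm_num, ?_⟩
  intro n _ G m p pcomp τ hτ hcomp hcase Ω _ P _ ξ hindep hξ
  exact theorem4_general hτ (fun i => (hcomp i).le) (hcase.imp le_of_lt le_of_lt) hindep hξ
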